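/- Let $\delta>0$. For $n\ge 0$ let $H_n(x,\delta)=2^n\prod_{j=1}^n(x-y_j)$, where $\bar q_j=\sqrt{ag}\,y_j$, $a,g>0$, $\delta=g/a$, and $\bar q_1,\dots,\bar q_n$ are pairwise distinct real numbers satisfying the equilibrium equations of the rational Ruijsenaars--Calogero system of type $A_{n-1}$ with linear confining potential, $$\prod_{k\ne j}\frac{\bar q_j-\bar q_k-ig}{\bar q_j-\bar q_k+ig}=\frac{a-i\bar q_j}{a+i\bar q_j}\qquad(j=1,\dots,n).$$ For every $n\ge0$ and $\delta>0$ such $\bar q$ exist, and the polynomial $H_n(x,\delta)$ does not depend on the choice of $\bar q$, $a$, $g$ (with $g/a=\delta$). Define, for $x\in\mathbb R$, $$w(x,\delta)=\frac1{\sqrt\pi}\int_{-\infty}^{\infty}\frac{\cos(2xt)}{(\cosh\sqrt\delta\,t)^{2/\delta}}\,dt .$$ This integral converges absolutely, $w(x,\delta)>0$, and $$w(x,\delta)=\frac{2^{2/\delta-1}}{\sqrt{\pi\delta}}\,B\Bigl(\frac1\delta+\frac{ix}{\sqrt\delta},\frac1\delta-\frac{ix}{\sqrt\delta}\Bigr)=\frac{2^{2/\delta-1}}{\sqrt{\pi\delta}}\,\frac{\Gamma\bigl(\frac1\delta+\frac{ix}{\sqrt\delta}\bigr)\Gamma\bigl(\frac1\delta-\frac{ix}{\sqrt\delta}\bigr)}{\Gamma(\frac2\delta)}=\frac{2^{2/\delta-1}}{\sqrt{\pi\delta}}\,\frac{\bigl|\Gamma\bigl(\frac1\delta+\frac{ix}{\sqrt\delta}\bigr)\bigr|^2}{\Gamma(\frac2\delta)}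 ,$$ where $B$ is Euler's Beta integral. The polynomials $H_n(x,\delta)$ are orthogonal on $\mathbb R$ with weight $w(x,\delta)$: for all $n,m\ge0$ the function $H_nH_mw$ is integrable and $$\int_{-\infty}^{\infty}H_n(x,\delta)H_m(x,\delta)\,w(x,\delta)\,dx=\begin{cases}h_n,&n=m,\\0,&n\ne m,\end{cases}\qquad h_n=\sqrt\pi\,2^n\,n!\prod_{j=0}^{n-1}\Bigl(1+\frac{j\delta}{2}\Bigr).$$ Moreover $\lim_{\delta\to0^+}w(x,\delta)=e^{-x^2}$ for every $x\in\mathbb R$. -/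

import Mathlib

open Polynomial

/-- The real positions `q 0, …, q (n - 1)` (pairwise distinct, since the pair interaction is
singular at coinciding positions) solve the equilibrium equations of the rational
Ruijsenaars-Calogero system of type `A_{n-1}` with linear confining potential and couplings
`a` and `g`:
`∏_{k ≠ j} (q_j - q_k - i g) / (q_j - q_k + i g) = (a - i q_j) / (a + i q_j)` for every `j`. -/
def IsEquilibriumA (a g : ℝ) {n : ℕ} (q : Fin n → ℝ) : Prop :=
  Function.Injective q ∧
    ∀ j : Fin n,
      ∏ k ∈ Finset.univ.erase j,
          (((q j - q k : ℝ) : ℂ) - Complex.I * (g : ℂ)) /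
            (((q j - q k : ℝ) : ℂ) + Complex.I * (g : ℂ)) =
        ((a : ℂ) - Complex.I * (q j : ℂ)) / ((a : ℂ) + Complex.I * (q j : ℂ))

/-- `P` is the deformed Hermite polynomial `H_n(x, δ) = 2^n ∏_j (x - y_j)`, where
`q_j = √(a g) y_j` are equilibrium positions for couplings `a, g > 0` with `δ = g / a`. -/
def IsDeformedHermite (δ : ℝ) (n : ℕ) (P : ℝ[X]) : Prop :=
  ∃ a g : ℝ, 0 < a ∧ 0 < g ∧ δ = g / a ∧
    ∃ q : Fin n → ℝ, IsEquilibriumA a g q ∧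
      P = C ((2 : ℝ) ^ n) * ∏ j : Fin n, (X - C (q j / √(a * g)))

/-- The integrand `cos(2xt) / (cosh(√δ t))^(2/δ)` of the weight function. -/
noncomputable def weightIntegrand (δ x t : ℝ) : ℝ :=
  Real.cos (2 * x * t) / Real.cosh (√δ * t) ^ (2 / δ)

/-- The weight function `w(x, δ) = ∫ cos(2xt) / (cosh(√δ t))^(2/δ) dt/√π`. -/
noncomputable def hermiteWeight (δ x : ℝ) : ℝ :=
  (1 / √Real.pi) * ∫ t : ℝ, weightIntegrand δ x t

/-! Write H_n for the polynomials given by H_{n+1} = 2x H_n - c_n H_{n-1} with c_n = n(2 + (n-1)δ).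
Two independent facts identify them: they are the polynomials of the equilibria, and they are
orthogonal for w.

Equilibria. Put w = i√δ and (Dp)(x) = (1+wx)p(x-w) + (1-wx)p(x+w). For a monic p with distinct roots
y_j, the equilibrium equations say precisely that Dp vanishes at every y_j (`isEquilibriumA_iff`).
The recurrence gives D H_n = (2+2nδ)H_n, so D is triangular with distinct eigenvalues. If deg p = n,
then Dp - (2+2nδ)p has degree below n and n distinct zeros, hence is zero, and p is proportional to
H_n (`eq_deformedHermite_of_eval_hermiteDiff`). Conversely H_n has n simple real roots, by a
Wronskian inequality and a half-plane argument, and these roots form an equilibrium. Existence and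
uniqueness follow together (`isDeformedHermite_iff`).

Orthogonality. Let f_n = tanh(√δ t)^n cosh(√δ t)^(-2/δ) and let F_n be its transform with kernel
exp(2ixt), so that F_0 = √π w(·,δ). Differentiating f_n gives a three-term recurrence for F_n, which
matches that of H_n up to constants: H_n F_0 = κ_n F_n
(`deformedHermite_mul_hermiteTransform_zero`). By Fourier inversion the integral of H_n w is a
multiple of f_n(0), which is 0 for n ≥ 1. A linear functional killing all H_n with n ≥ 1 makes them
orthogonal with norms L(1) c_1 ⋯ c_n.

The closed forms of w come from the substitution s = sigmoid t in Euler's Beta integral, and the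
limit from dominated convergence. -/

/-- The deformed Hermite polynomials, defined by their three-term recurrence. -/
noncomputable def deformedHermite {R : Type*} [CommRing R] (δ : R) : ℕ → R[X]
  | 0 => 1
  | 1 => C 2 * X
  | n + 2 => C 2 * X * deformedHermite δ (n + 1) -
      C (((n : R) + 1) * (2 + n * δ)) * deformedHermite δ n

/-- The coefficient of the three-term recurrence. -/
def hermiteCoeff {R : Type*} [CommRing R] (δ : R) (n : ℕ) : R := n * (2 + (n - 1) * δ)

/-! ### The recurrence and the difference operator. -/

section Recurrence

variable {R : Type*} [CommRing R] (δ w : R)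

/-- Truncated subtraction is harmless at `n = 0`, since `hermiteCoeff δ 0 = 0`; this lets later
arguments treat all indices uniformly. -/
theorem deformedHermite_succ (n : ℕ) :
    deformedHermite δ (n + 1) = C 2 * X * deformedHermite δ n -
      C (hermiteCoeff δ n) * deformedHermite δ (n - 1) := by
  cases n with
  | zero => simp [deformedHermite, hermiteCoeff]
  | succ n => simp [deformedHermite, hermiteCoeff]

theorem map_deformedHermite {S : Type*} [CommRing S] (f : R →+* S) (n : ℕ) :
    (deformedHermite δ n).map f = deformedHermite (f δ) n := by
  induction n using Nat.strong_induction_on with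
  | _ n ih =>
    match n with
    | 0 => simp [deformedHermite]
    | 1 => simp [deformedHermite, map_ofNat f]
    | n + 2 =>
      have h : f ((n + 1) * (2 + n * δ)) = (n + 1) * (2 + n * f δ) := by
        rw [map_mul, map_add, map_add, map_mul, map_natCast, map_one, map_ofNat]
      rw [deformedHermite, deformedHermite, Polynomial.map_sub, Polynomial.map_mul,
        Polynomial.map_mul, Polynomial.map_mul, map_C, map_C, map_X, ih n (by omega),
        ih (n + 1) (by omega), h, map_ofNat]

/-- The difference operator diagonalized by the deformed Hermite polynomials. -/
noncomputable def hermiteDiff : R[X] →ₗ[R] R[X] where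
  toFun p := (1 + C w * X) * p.comp (X - C w) + (1 - C w * X) * p.comp (X + C w)
  map_add' p q := by simp only [add_comp]; ring
  map_smul' r p := by
    simp only [smul_eq_C_mul, mul_comp, C_comp, RingHom.id_apply]; ring

/-- The commutator of `hermiteDiff` with the multiplication by `X`. -/
noncomputable def hermiteDiffComm : R[X] →ₗ[R] R[X] where
  toFun p := -C w * (1 + C w * X) * p.comp (X - C w) + C w * (1 - C w * X) * p.comp (X + C w)
  map_add' p q := by simp only [add_comp]; ring
  map_smul' r p := by
    simp only [smul_eq_C_mul, mul_comp, C_comp, RingHom.id_apply]; ring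

theorem hermiteDiff_apply (p : R[X]) : hermiteDiff w p =
    (1 + C w * X) * p.comp (X - C w) + (1 - C w * X) * p.comp (X + C w) := rfl

theorem hermiteDiff_X_mul (p : R[X]) :
    hermiteDiff w (X * p) = X * hermiteDiff w p + hermiteDiffComm w p := by
  simp only [hermiteDiff, hermiteDiffComm, LinearMap.coe_mk, AddHom.coe_mk, mul_comp, X_comp]
  ring

/-- Commuting with `X` a second time returns D itself, up to the factor w². The pair D, E = [D, X]
is therefore closed under commutation with `X`, which makes a joint induction possible. -/
theorem hermiteDiffComm_X_mul (p : R[X]) :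
    hermiteDiffComm w (X * p) = X * hermiteDiffComm w p + C (w ^ 2) * hermiteDiff w p := by
  simp only [hermiteDiff, hermiteDiffComm, LinearMap.coe_mk, AddHom.coe_mk, mul_comp, X_comp,
    C_pow]
  ring

theorem hermiteDiff_C_mul (r : R) (p : R[X]) :
    hermiteDiff w (C r * p) = C r * hermiteDiff w p := by
  rw [← smul_eq_C_mul, map_smul, smul_eq_C_mul]

theorem hermiteDiffComm_C_mul (r : R) (p : R[X]) :
    hermiteDiffComm w (C r * p) = C r * hermiteDiffComm w p := by
  rw [← smul_eq_C_mul, map_smul, smul_eq_C_mul]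

variable {δ w}

/-- The eigenvalue equation alone does not propagate along the recurrence: D(X H_n) involves E H_n.
Both actions are proved together, each following from the recurrence and the two commutation rules.
-/
theorem hermiteDiff_deformedHermite_aux (hw : w ^ 2 = -δ) (n : ℕ) :
    hermiteDiff w (deformedHermite δ n) = C (2 + 2 * n * δ) * deformedHermite δ n ∧
    hermiteDiffComm w (deformedHermite δ n) = C δ * (deformedHermite δ (n + 1) -
      C (hermiteCoeff δ n) * deformedHermite δ (n - 1)) := by
  induction n using Nat.strong_induction_on with
  | _ n ih =>
    match n with
    | 0 =>
      have hw' : C w ^ 2 = -(C δ : R[X]) := by rw [← C_pow, hw, C_neg]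
      constructor
      · simp [deformedHermite, hermiteDiff, C_ofNat]
        norm_num
      · simp [deformedHermite, hermiteDiffComm, hermiteCoeff, C_ofNat]
        linear_combination (-2 * X) * hw'
    | n + 1 =>
      obtain ⟨hD, hE⟩ := ih n (by omega)
      have h1 := deformedHermite_succ δ n
      have h2 := deformedHermite_succ δ (n + 1)
      -- The induction hypothesis at `n - 1` is multiplied by c_n, so that it also covers `n = 0`;
      -- `h0` treats the recurrence for H_n likewise.
      have hm : hermiteDiff w (C (hermiteCoeff δ n) * deformedHermite δ (n - 1)) =
          C (hermiteCoeff δ n) * (C (2 + 2 * (n - 1) * δ) * deformedHermite δ (n - 1)) ∧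
          hermiteDiffComm w (C (hermiteCoeff δ n) * deformedHermite δ (n - 1)) =
          C (hermiteCoeff δ n) * (C δ * (deformedHermite δ n -
            C (hermiteCoeff δ (n - 1)) * deformedHermite δ (n - 1 - 1))) := by
        cases n with
        | zero => simp [hermiteCoeff]
        | succ n =>
          obtain ⟨hD', hE'⟩ := ih n (by omega)
          rw [hermiteDiff_C_mul, hermiteDiffComm_C_mul, Nat.add_sub_cancel, hD', hE']
          simp
      have h0 : C (hermiteCoeff δ n) * deformedHermite δ n = C (hermiteCoeff δ n) *
          (C 2 * X * deformedHermite δ (n - 1) -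
            C (hermiteCoeff δ (n - 1)) * deformedHermite δ (n - 1 - 1)) := by
        cases n with
        | zero => simp [hermiteCoeff]
        | succ n => rw [deformedHermite_succ δ n]; rfl
      -- The increments c_{n+1} - c_n are exactly the eigenvalues 2 + 2nδ.
      have hc : (C (hermiteCoeff δ (n + 1)) : R[X]) = C (hermiteCoeff δ n) + 2 + 2 * n * C δ := by
        simp only [hermiteCoeff, C_mul, C_add, C_sub, C_1, C_eq_natCast, C_ofNat]
        push_cast
        ring
      simp only [C_add, C_mul, C_ofNat, C_eq_natCast, C_sub, C_1] at hD hm h1 h2 h0 ⊢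
      push_cast
      simp only [Nat.add_sub_cancel] at h2 ⊢
      constructor
      · rw [h1, map_sub, hm.1, mul_assoc, ← C_ofNat, hermiteDiff_C_mul, hermiteDiff_X_mul, hD, hE,
          h1, C_ofNat]
        ring
      · rw [h2]
        rw [h1, map_sub, hm.2, mul_assoc, ← C_ofNat, hermiteDiffComm_C_mul, hermiteDiffComm_X_mul,
          hD, hE, hw, h1, C_ofNat, hc, C_neg]
        linear_combination C δ * h0

theorem hermiteDiff_deformedHermite (hw : w ^ 2 = -δ) (n : ℕ) :
    hermiteDiff w (deformedHermite δ n) = C (2 + 2 * n * δ) * deformedHermite δ n :=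
  (hermiteDiff_deformedHermite_aux hw n).1

end Recurrence

/-! ### Degree and leading coefficient. -/

section Degree

variable {R : Type*} [CommRing R] (δ : R)

theorem natDegree_deformedHermite_le (n : ℕ) : (deformedHermite δ n).natDegree ≤ n := by
  induction n using Nat.strong_induction_on with
  | _ n ih =>
    match n with
    | 0 => simp [deformedHermite]
    | 1 => exact (natDegree_C_mul_le _ _).trans natDegree_X_le
    | n + 2 =>
      rw [deformedHermite]
      refine (natDegree_sub_le _ _).trans (max_le ?_ ?_)
      · refine natDegree_mul_le.trans ?_
        have := ih (n + 1) (by omega)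
        have := (natDegree_C_mul_le (2 : R) X).trans natDegree_X_le
        omega
      · refine (natDegree_C_mul_le _ _).trans ((ih n (by omega)).trans (by omega))

theorem coeff_deformedHermite_self (n : ℕ) : (deformedHermite δ n).coeff n = 2 ^ n := by
  induction n using Nat.strong_induction_on with
  | _ n ih =>
    match n with
    | 0 => simp [deformedHermite]
    | 1 => simp [deformedHermite]
    | n + 2 =>
      rw [deformedHermite, coeff_sub, mul_assoc, coeff_C_mul, coeff_X_mul, ih _ (by omega),
        coeff_C_mul, coeff_eq_zero_of_natDegree_lt
          ((natDegree_deformedHermite_le δ n).trans_lt (by omega))]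
      ring

theorem natDegree_deformedHermite [CharZero R] [IsDomain R] (n : ℕ) :
    (deformedHermite δ n).natDegree = n :=
  natDegree_eq_of_le_of_coeff_ne_zero (natDegree_deformedHermite_le δ n)
    (by rw [coeff_deformedHermite_self]; exact pow_ne_zero n two_ne_zero)

theorem degree_deformedHermite_le (n : ℕ) : (deformedHermite δ n).degree ≤ n :=
  degree_le_of_natDegree_le (natDegree_deformedHermite_le δ n)

theorem degree_C_mul_le_degree (r : R) (p : R[X]) : (C r * p).degree ≤ p.degree := by
  rw [← smul_eq_C_mul]
  exact degree_smul_le r p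

end Degree

/-! ### Triangularity of D and uniqueness of its eigenpolynomials. -/

section Field

variable {K : Type*} [Field K] [CharZero K] {δ w : K}

/-- A polynomial of degree at most `n` is a multiple of the `n`-th deformed Hermite polynomial
up to lower order terms. -/
theorem degree_sub_C_mul_deformedHermite_lt {n : ℕ} {p : K[X]} (hp : p.degree ≤ n) :
    (p - C (p.coeff n / 2 ^ n) * deformedHermite δ n).degree < n := by
  rw [degree_lt_iff_coeff_zero]
  intro m hm
  rw [coeff_sub, coeff_C_mul]
  rcases hm.eq_or_lt with rfl | hm
  · rw [coeff_deformedHermite_self, div_mul_cancel₀ _ (by simp), sub_self]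
  · rw [coeff_eq_zero_of_degree_lt (hp.trans_lt (by exact_mod_cast hm)),
      coeff_eq_zero_of_natDegree_lt ((natDegree_deformedHermite_le δ n).trans_lt hm)]
    simp

/-- The factors 1 ± wX could raise the degree; they do not, because D is diagonal in the basis H_n.
The induction peels off the top multiple of H_n. -/
theorem degree_hermiteDiff_lt (hw : w ^ 2 = -δ) {n : ℕ} {p : K[X]} (hp : p.degree < n) :
    (hermiteDiff w p).degree < n := by
  induction n generalizing p with
  | zero =>
    have : p = 0 := by simpa using hp
    simp [this]
  | succ n ih =>
    have hp' : p.degree ≤ n := by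
      rw [degree_le_iff_coeff_zero]
      intro m hm
      exact coeff_eq_zero_of_degree_lt (hp.trans_le (by exact_mod_cast hm))
    have h := ih (degree_sub_C_mul_deformedHermite_lt (δ := δ) hp')
    rw [map_sub, hermiteDiff_C_mul, hermiteDiff_deformedHermite hw, ← mul_assoc, ← C_mul] at h
    have h2 : (hermiteDiff w p).degree ≤ n := by
      rw [← sub_add_cancel (hermiteDiff w p)
        (C (p.coeff n / 2 ^ n * (2 + 2 * n * δ)) * deformedHermite δ n)]
      refine (degree_add_le _ _).trans (max_le h.le ?_)
      exact (degree_C_mul_le_degree _ _).trans (degree_deformedHermite_le δ n)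
    exact h2.trans_lt (by exact_mod_cast n.lt_succ_self)

theorem degree_hermiteDiff_sub_lt (hw : w ^ 2 = -δ) {n : ℕ} {p : K[X]} (hp : p.degree ≤ n) :
    (hermiteDiff w p - C (2 + 2 * n * δ) * p).degree < n := by
  set r := p - C (p.coeff n / 2 ^ n) * deformedHermite δ n with hr
  have h : r.degree < n := degree_sub_C_mul_deformedHermite_lt hp
  have : hermiteDiff w p - C (2 + 2 * n * δ) * p =
      hermiteDiff w r - C (2 + 2 * n * δ) * r := by
    rw [hr, map_sub, hermiteDiff_C_mul, hermiteDiff_deformedHermite hw]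
    ring
  rw [this]
  exact (degree_sub_le _ _).trans_lt
    (max_lt (degree_hermiteDiff_lt hw h) ((degree_C_mul_le_degree _ _).trans_lt h))

/-- Uniqueness of the polynomial eigenfunctions of the difference operator. -/
theorem eq_zero_of_hermiteDiff_eq (hw : w ^ 2 = -δ) (hδ : δ ≠ 0) {n : ℕ} {p : K[X]}
    (hp : p.degree < n) (h : hermiteDiff w p = C (2 + 2 * n * δ) * p) : p = 0 := by
  by_contra h0
  have hlt : p.natDegree < n := by rwa [natDegree_lt_iff_degree_lt h0]
  have h1 := degree_hermiteDiff_sub_lt hw (degree_le_natDegree (p := p))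
  rw [h, ← sub_mul, ← C_sub, degree_C_mul, degree_eq_natDegree h0] at h1
  · exact lt_irrefl _ h1
  · have : (n : K) - p.natDegree ≠ 0 := sub_ne_zero.2 (by exact_mod_cast hlt.ne')
    have h3 := mul_ne_zero (mul_ne_zero two_ne_zero this) hδ
    intro h2
    exact h3 (by linear_combination h2)

/-- A polynomial of degree `n` with the same leading coefficient as the deformed Hermite
polynomial, and whose image under the difference operator vanishes at its `n` distinct roots,
is the deformed Hermite polynomial. -/
theorem eq_deformedHermite_of_eval_hermiteDiff (hw : w ^ 2 = -δ) (hδ : δ ≠ 0) {n : ℕ} {p : K[X]}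
    (hp : p.degree ≤ n) (hc : p.coeff n = 2 ^ n) {y : Fin n → K} (hy : Function.Injective y)
    (h0 : ∀ j, p.eval (y j) = 0) (hD : ∀ j, (hermiteDiff w p).eval (y j) = 0) :
    p = deformedHermite δ n := by
  have h1 : hermiteDiff w p - C (2 + 2 * n * δ) * p = 0 := by
    refine eq_zero_of_degree_lt_of_eval_index_eq_zero Finset.univ hy.injOn
      (by rw [Finset.card_fin]; exact degree_hermiteDiff_sub_lt hw hp) fun j _ => ?_
    simp [h0, hD]
  have h2 := degree_sub_C_mul_deformedHermite_lt (δ := δ) hp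
  rw [hc, div_self (by simp), C_1, one_mul] at h2
  refine sub_eq_zero.1 (eq_zero_of_hermiteDiff_eq hw hδ h2 ?_)
  rw [map_sub, hermiteDiff_deformedHermite hw, sub_eq_zero.1 h1, mul_sub]

end Field

/-! ### Reality and simplicity of the zeros. -/

section RealZeros

variable {δ : ℝ}

theorem hermiteCoeff_nonneg (hδ : 0 ≤ δ) (n : ℕ) : 0 ≤ hermiteCoeff δ n := by
  unfold hermiteCoeff
  cases n with
  | zero => simp
  | succ n => push_cast; rw [add_sub_cancel_right]; positivity

/-- The Christoffel-Darboux inequality: consecutive deformed Hermite polynomials have positive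
Wronskian. -/
theorem deformedHermite_wronskian_pos (hδ : 0 ≤ δ) (n : ℕ) (x : ℝ) :
    0 < (derivative (deformedHermite δ (n + 1))).eval x * (deformedHermite δ n).eval x -
      (deformedHermite δ (n + 1)).eval x * (derivative (deformedHermite δ n)).eval x := by
  induction n with
  | zero => simp [deformedHermite]
  | succ n ih =>
    have hc : 0 < hermiteCoeff δ (n + 1) := by
      unfold hermiteCoeff
      push_cast
      rw [add_sub_cancel_right]
      positivity
    rw [deformedHermite_succ δ (n + 1), Nat.add_sub_cancel]
    simp only [derivative_sub, derivative_mul, derivative_C, derivative_X, eval_sub, eval_add,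
      eval_mul, eval_C, eval_X, zero_mul, zero_add, mul_one]
    -- With W_n the Wronskian at level n, W_{n+1} = 2 H_{n+1}² + c_{n+1} W_n.
    nlinarith [mul_pos hc ih, sq_nonneg ((deformedHermite δ (n + 1)).eval x)]

theorem deformedHermite_eval_derivative_ne_zero (hδ : 0 ≤ δ) (n : ℕ) {x : ℝ}
    (hx : (deformedHermite δ n).eval x = 0) : (derivative (deformedHermite δ n)).eval x ≠ 0 := by
  cases n with
  | zero => simp [deformedHermite] at hx
  | succ n =>
    have h := deformedHermite_wronskian_pos hδ n x
    intro h0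
    simp [hx, h0] at h

/-- The imaginary part of the ratio of consecutive deformed Hermite polynomials is positive on the
upper half plane. -/
theorem deformedHermite_im_pos (hδ : 0 ≤ δ) {z : ℂ} (hz : 0 < z.im) (n : ℕ) :
    0 < (aeval z (deformedHermite δ (n + 1)) *
      starRingEnd ℂ (aeval z (deformedHermite δ n))).im := by
  induction n with
  | zero => simpa [deformedHermite, aeval_def] using hz
  | succ n ih =>
    have h0 : aeval z (deformedHermite δ (n + 1)) ≠ 0 := by
      intro h
      simp [h] at ih
    have h1 : 0 < z.im * Complex.normSq (aeval z (deformedHermite δ (n + 1))) :=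
      mul_pos hz (Complex.normSq_pos.2 h0)
    have h2 := mul_nonneg (hermiteCoeff_nonneg hδ (n + 1)) ih.le
    rw [deformedHermite_succ δ (n + 1), Nat.add_sub_cancel]
    simp only [map_sub, map_mul, aeval_C, aeval_X, Complex.coe_algebraMap]
    rw [Complex.normSq_apply] at h1
    simp only [Complex.mul_im, Complex.mul_re, Complex.sub_im, Complex.sub_re, Complex.conj_im,
      Complex.conj_re, Complex.ofReal_re, Complex.ofReal_im] at h2 ⊢
    -- Im(H_{n+2} conj H_{n+1}) = 2 Im z |H_{n+1}|² + c_{n+1} Im(H_{n+1} conj H_n).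
    nlinarith

theorem deformedHermite_aeval_ne_zero (hδ : 0 ≤ δ) {z : ℂ} (hz : 0 < z.im) (n : ℕ) :
    aeval z (deformedHermite δ n) ≠ 0 := by
  intro h
  have := deformedHermite_im_pos hδ hz n
  simp [h] at this

/-- A nonreal complex root, or its conjugate, would lie in the upper half plane, where there are no
roots. -/
theorem deformedHermite_splits (hδ : 0 ≤ δ) (n : ℕ) : (deformedHermite δ n).Splits := by
  refine Splits.of_splits_map (algebraMap ℝ ℂ) (IsAlgClosed.splits _) fun z hz => ?_
  have h0 : aeval z (deformedHermite δ n) = 0 := by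
    rw [← eval_map_algebraMap]
    exact isRoot_of_mem_roots hz
  have h1 : z.im = 0 := by
    rcases lt_trichotomy z.im 0 with h | h | h
    · refine absurd ?_ (deformedHermite_aeval_ne_zero hδ (z := starRingEnd ℂ z) (by simpa) n)
      rw [aeval_conj, h0, map_zero]
    · exact h
    · exact absurd h0 (deformedHermite_aeval_ne_zero hδ h n)
  exact ⟨z.re, Complex.ext (by simp) (by simp [h1])⟩

/-- The deformed Hermite polynomials have real and simple zeros. -/
theorem exists_deformedHermite_eq_prod (hδ : 0 ≤ δ) (n : ℕ) :
    ∃ y : Fin n → ℝ, Function.Injective y ∧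
      deformedHermite δ n = C (2 ^ n) * ∏ j, (X - C (y j)) := by
  have hne : deformedHermite δ n ≠ 0 := by
    intro h
    have := coeff_deformedHermite_self δ n
    rw [h, coeff_zero] at this
    exact pow_ne_zero n two_ne_zero this.symm
  have hs := deformedHermite_splits hδ n
  have hnd : (deformedHermite δ n).roots.Nodup := by
    rw [Multiset.nodup_iff_count_le_one]
    intro x
    rw [count_roots]
    by_contra! h
    rw [one_lt_rootMultiplicity_iff_isRoot hne] at h
    exact deformedHermite_eval_derivative_ne_zero hδ n h.1 h.2
  have hcard : (deformedHermite δ n).roots.toFinset.card = n := by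
    rw [Multiset.toFinset_card_of_nodup hnd, ← hs.natDegree_eq_card_roots,
      natDegree_deformedHermite]
  let e := (deformedHermite δ n).roots.toFinset.equivFinOfCardEq hcard
  refine ⟨fun j => e.symm j, Subtype.val_injective.comp e.symm.injective, ?_⟩
  conv_lhs => rw [hs.eq_prod_roots]
  rw [leadingCoeff, natDegree_deformedHermite, coeff_deformedHermite_self]
  congr 1
  rw [e.symm.prod_comp (fun x => X - C (x : ℝ)), Finset.prod_coe_sort _ fun x : ℝ => X - C x,
    Finset.prod_multiset_map_count]
  refine Finset.prod_congr rfl fun x hx => ?_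
  rw [Multiset.count_eq_one_of_mem hnd (Multiset.mem_toFinset.1 hx), pow_one]

end RealZeros

/-! ### Equilibrium equations as vanishing of Dp at the roots of p. -/

section Equilibrium

/-- The factor `k = j` contributes -w in p(y_j - w) and +w in p(y_j + w); this is the source of the
common factor and of the minus sign. -/
theorem eval_hermiteDiff_prod {K : Type*} [CommRing K] {n : ℕ} (w : K) (y : Fin n → K)
    (j : Fin n) :
    (hermiteDiff w (∏ k, (X - C (y k)))).eval (y j) =
      w * ((1 - w * y j) * ∏ k ∈ Finset.univ.erase j, (y j - y k + w) -
        (1 + w * y j) * ∏ k ∈ Finset.univ.erase j, (y j - y k - w)) := by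
  simp only [hermiteDiff_apply, eval_add, eval_mul, eval_sub, eval_one, eval_C, eval_X, eval_comp,
    eval_prod]
  rw [← Finset.mul_prod_erase _ _ (Finset.mem_univ j),
    ← Finset.mul_prod_erase _ (fun k => y j + w - y k) (Finset.mem_univ j)]
  simp only [sub_right_comm (y j) w, add_sub_right_comm (y j) w]
  ring

theorem ofReal_add_I_mul_ofReal_ne_zero (x : ℝ) {y : ℝ} (hy : y ≠ 0) :
    (x : ℂ) + Complex.I * y ≠ 0 := by
  intro h
  exact hy (by simpa using congrArg Complex.im h)

theorem one_add_I_mul_ofReal_ne_zero (x : ℝ) : 1 + Complex.I * (x : ℂ) ≠ 0 := by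
  intro h
  simpa using congrArg Complex.re h

/-- In the variables y = q / √(ag) only s = √(g/a) survives, because √(ag) s = g and a s = √(ag).
Clearing denominators then gives the bracket in `eval_hermiteDiff_prod`; they are nonzero because
the y_j are real and s > 0. -/
theorem isEquilibriumA_iff {a g : ℝ} (ha : 0 < a) (hg : 0 < g) {n : ℕ} (q : Fin n → ℝ) :
    IsEquilibriumA a g q ↔ Function.Injective q ∧ ∀ j,
      (hermiteDiff (Complex.I * (√(g / a) : ℝ)) (∏ k, (X - C ((q k / √(a * g) : ℝ) : ℂ)))).eval
        ((q j / √(a * g) : ℝ) : ℂ) = 0 := by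
  refine and_congr_right fun _ => forall_congr' fun j => ?_
  set r := √(a * g) with hr
  set s := √(g / a) with hs
  have hr0 : 0 < r := Real.sqrt_pos.2 (mul_pos ha hg)
  have hs0 : 0 < s := Real.sqrt_pos.2 (div_pos hg ha)
  have hrs : r * s = g := by
    rw [hr, hs, ← Real.sqrt_mul (mul_pos ha hg).le, mul_right_comm,
      mul_div_cancel₀ _ ha.ne', Real.sqrt_mul_self hg.le]
  have has : a * s = r := by
    rw [← mul_self_inj (by positivity) (by positivity), hr, hs, Real.mul_self_sqrt (by positivity),
      mul_mul_mul_comm, Real.mul_self_sqrt (by positivity)]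
    field_simp
  have hrC : (r : ℂ) ≠ 0 := by exact_mod_cast hr0.ne'
  have haC : (a : ℂ) ≠ 0 := by exact_mod_cast ha.ne'
  have hrsC : (r : ℂ) * s = g := by exact_mod_cast hrs
  have hasC : (a : ℂ) * s = r := by exact_mod_cast has
  rw [eval_hermiteDiff_prod _ (fun k => ((q k / r : ℝ) : ℂ)), mul_eq_zero,
    or_iff_right (by simp [hs0.ne']), sub_eq_zero]
  have h1 : ∀ k, (((q j - q k : ℝ) : ℂ) - Complex.I * g) / (((q j - q k : ℝ) : ℂ) + Complex.I * g) =
      (((q j / r : ℝ) : ℂ) - ((q k / r : ℝ) : ℂ) - Complex.I * s) /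
        (((q j / r : ℝ) : ℂ) - ((q k / r : ℝ) : ℂ) + Complex.I * s) := by
    intro k
    refine Eq.trans ?_ (mul_div_mul_left _ _ hrC)
    congr 1 <;> rw [← hrsC] <;> push_cast <;> field_simp
  have h2 : ((a : ℂ) - Complex.I * q j) / (a + Complex.I * q j) =
      (1 - Complex.I * s * ((q j / r : ℝ) : ℂ)) / (1 + Complex.I * s * ((q j / r : ℝ) : ℂ)) := by
    refine Eq.trans ?_ (mul_div_mul_left _ _ haC)
    congr 1
    · push_cast
      field_simp
      linear_combination (Complex.I * q j) * hasC
    · push_cast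
      field_simp
      linear_combination -(Complex.I * q j) * hasC
  rw [Finset.prod_congr rfl fun k _ => h1 k, h2, Finset.prod_div_distrib, div_eq_div_iff]
  · rw [mul_comm _ (1 + _)]
    exact eq_comm
  · refine Finset.prod_ne_zero_iff.2 fun k _ => ?_
    rw [← Complex.ofReal_sub]
    exact ofReal_add_I_mul_ofReal_ne_zero _ hs0.ne'
  · rw [mul_assoc, ← Complex.ofReal_mul]
    exact one_add_I_mul_ofReal_ne_zero _

theorem I_mul_sqrt_sq {δ : ℝ} (hδ : 0 ≤ δ) : (Complex.I * (√δ : ℝ)) ^ 2 = -(δ : ℂ) := by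
  rw [mul_pow, Complex.I_sq, ← Complex.ofReal_pow, Real.sq_sqrt hδ, neg_one_mul]

/-- The polynomials attached to the equilibrium positions are the ones given by the
recurrence. -/
theorem isDeformedHermite_iff {δ : ℝ} (hδ : 0 < δ) {n : ℕ} {P : ℝ[X]} :
    IsDeformedHermite δ n P ↔ P = deformedHermite δ n := by
  have hw := I_mul_sqrt_sq hδ.le
  constructor
  · rintro ⟨a, g, ha, hg, rfl, q, hq, rfl⟩
    rw [isEquilibriumA_iff ha hg] at hq
    have hr0 : √(a * g) ≠ 0 := (Real.sqrt_pos.2 (mul_pos ha hg)).ne'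
    apply map_injective (algebraMap ℝ ℂ) (algebraMap ℝ ℂ).injective
    rw [map_deformedHermite]
    have hmap : (C (2 ^ n) * ∏ j, (X - C (q j / √(a * g)))).map (algebraMap ℝ ℂ) =
        C (2 ^ n) * ∏ j, (X - C ((q j / √(a * g) : ℝ) : ℂ)) := by
      rw [Polynomial.map_mul, Polynomial.map_prod, map_C]
      simp
    have hmon : (∏ j, (X - C ((q j / √(a * g) : ℝ) : ℂ))).Monic := monic_prod_X_sub_C _ _
    have hdeg : (∏ j, (X - C ((q j / √(a * g) : ℝ) : ℂ))).natDegree = n := by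
      rw [natDegree_finsetProd_X_sub_C_eq_card, Finset.card_fin]
    rw [hmap]
    refine eq_deformedHermite_of_eval_hermiteDiff hw (by exact_mod_cast hδ.ne')
      (y := fun j => ((q j / √(a * g) : ℝ) : ℂ)) ?_ ?_ ?_ ?_ ?_
    · refine (degree_C_mul_le_degree _ _).trans ?_
      rw [degree_eq_natDegree hmon.ne_zero, hdeg]
    · have := hmon.coeff_natDegree
      rw [hdeg] at this
      rw [coeff_C_mul, this, mul_one]
    · intro i j hij
      exact hq.1 ((div_left_inj' hr0).1 (Complex.ofReal_injective hij))
    · intro j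
      rw [eval_mul, eval_prod, Finset.prod_eq_zero (Finset.mem_univ j) (by simp), mul_zero]
    · intro j
      rw [hermiteDiff_C_mul, eval_mul, hq.2 j, mul_zero]
  · rintro rfl
    obtain ⟨y, hy, h⟩ := exists_deformedHermite_eq_prod hδ.le n
    have hs0 : 0 < √δ := Real.sqrt_pos.2 hδ
    -- The choice a = 1, g = δ makes the scale √(ag) equal to √δ.
    refine ⟨1, δ, one_pos, hδ, by simp, fun j => √δ * y j, ?_, ?_⟩
    · rw [isEquilibriumA_iff one_pos hδ]
      refine ⟨fun i j hij => hy (mul_left_cancel₀ hs0.ne' hij), fun j => ?_⟩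
      simp only [one_mul, div_one, mul_div_cancel_left₀ _ hs0.ne']
      have hC : C ((2 : ℂ) ^ n) * ∏ k, (X - C ((y k : ℝ) : ℂ)) = deformedHermite (δ : ℂ) n := by
        have := congrArg (Polynomial.map (algebraMap ℝ ℂ)) h
        rw [map_deformedHermite, Polynomial.map_mul, Polynomial.map_prod, map_C] at this
        simpa using this.symm
      have hD := hermiteDiff_deformedHermite hw n
      rw [← hC, hermiteDiff_C_mul] at hD
      have := congrArg (eval ((y j : ℝ) : ℂ)) hD
      have h0 : eval ((y j : ℝ) : ℂ) (∏ k, (X - C ((y k : ℝ) : ℂ))) = 0 := by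
        rw [eval_prod, Finset.prod_eq_zero (Finset.mem_univ j) (by simp)]
      rw [eval_mul, eval_mul, eval_mul, h0, mul_zero, mul_zero, mul_eq_zero, eval_C] at this
      exact this.resolve_left (pow_ne_zero n two_ne_zero)
    · simp only [one_mul, mul_div_cancel_left₀ _ hs0.ne']
      exact h

end Equilibrium

/-! ### The Beta integral as a Fourier integral of a power of cosh. -/

section BetaIntegral

open MeasureTheory Set

theorem log_sigmoid (t : ℝ) :
    Real.log (Real.sigmoid t) = t / 2 - Real.log (2 * Real.cosh (t / 2)) := by
  have h : Real.sigmoid t = Real.exp (t / 2) / (2 * Real.cosh (t / 2)) := by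
    rw [Real.sigmoid_def, inv_eq_one_div, div_eq_div_iff (by positivity)
      (by have := Real.cosh_pos (t / 2); positivity), Real.cosh_eq, mul_add, ← Real.exp_add]
    ring_nf
  rw [h, Real.log_div (Real.exp_ne_zero _) (by have := Real.cosh_pos (t / 2); positivity),
    Real.log_exp]

/-- For s = sigmoid t one has s = e^{t/2} / (2 cosh(t/2)) and 1 - s = e^{-t/2} / (2 cosh(t/2)),
while ds/dt = s(1-s) absorbs the two exponents -1. -/
theorem sigmoid_beta_integrand (α y t : ℝ) :
    |Real.sigmoid t * (1 - Real.sigmoid t)| •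
      ((Real.sigmoid t : ℂ) ^ ((α : ℂ) + Complex.I * y - 1) *
        (1 - (Real.sigmoid t : ℂ)) ^ ((α : ℂ) - Complex.I * y - 1)) =
      (((2 * Real.cosh (t / 2)) ^ (-(2 * α)) : ℝ) : ℂ) * Complex.exp (Complex.I * y * t) := by
  have h1 := Real.sigmoid_pos t
  have h2 : 0 < 1 - Real.sigmoid t := by linarith [Real.sigmoid_lt_one t]
  have e2 : Real.log (1 - Real.sigmoid t) = -t / 2 - Real.log (2 * Real.cosh (t / 2)) := by
    rw [← Real.sigmoid_neg, log_sigmoid, neg_div, Real.cosh_neg]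
  have e1 := log_sigmoid t
  have c1 : ((Real.sigmoid t : ℝ) : ℂ) = Complex.exp ((Real.log (Real.sigmoid t) : ℝ) : ℂ) := by
    rw [← Complex.ofReal_exp, Real.exp_log h1]
  have c2 : ((1 - Real.sigmoid t : ℝ) : ℂ) =
      Complex.exp ((Real.log (1 - Real.sigmoid t) : ℝ) : ℂ) := by
    rw [← Complex.ofReal_exp, Real.exp_log h2]
  have hc : 0 < 2 * Real.cosh (t / 2) := by have := Real.cosh_pos (t / 2); positivity
  rw [abs_of_pos (mul_pos h1 h2), Complex.real_smul, Complex.ofReal_mul,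
    ← Complex.ofReal_one, ← Complex.ofReal_sub,
    Complex.cpow_def_of_ne_zero (by exact_mod_cast h1.ne'),
    Complex.cpow_def_of_ne_zero (by exact_mod_cast h2.ne'),
    ← Complex.ofReal_log h1.le, ← Complex.ofReal_log h2.le, c1, c2, ← Complex.exp_add,
    ← Complex.exp_add, ← Complex.exp_add, Real.rpow_def_of_pos hc, Complex.ofReal_exp,
    ← Complex.exp_add, e1, e2]
  congr 1
  push_cast
  ring

theorem image_sigmoid_univ : Real.sigmoid '' univ = Ioo 0 1 := by
  rw [image_univ, Real.range_sigmoid]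

theorem integrable_cosh_rpow_mul_exp {α : ℝ} (hα : 0 < α) (y : ℝ) :
    Integrable fun t : ℝ => (((2 * Real.cosh (t / 2)) ^ (-(2 * α)) : ℝ) : ℂ) *
      Complex.exp (Complex.I * y * t) := by
  have h := Complex.betaIntegral_convergent (u := (α : ℂ) + Complex.I * y)
    (v := (α : ℂ) - Complex.I * y) (by simpa) (by simpa)
  rw [intervalIntegrable_iff_integrableOn_Ioo_of_le zero_le_one, ← image_sigmoid_univ,
    integrableOn_image_iff_integrableOn_abs_deriv_smul MeasurableSet.univ
      (fun t _ => (Real.hasDerivAt_sigmoid t).hasDerivWithinAt) Real.sigmoid_injective.injOn,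
    integrableOn_univ] at h
  exact h.congr (Filter.Eventually.of_forall fun t => sigmoid_beta_integrand α y t)

theorem betaIntegral_eq_integral_cosh_rpow (α y : ℝ) :
    Complex.betaIntegral ((α : ℂ) + Complex.I * y) ((α : ℂ) - Complex.I * y) =
      ∫ t : ℝ, (((2 * Real.cosh (t / 2)) ^ (-(2 * α)) : ℝ) : ℂ) *
        Complex.exp (Complex.I * y * t) := by
  rw [Complex.betaIntegral, intervalIntegral.integral_of_le zero_le_one,
    integral_Ioc_eq_integral_Ioo, ← image_sigmoid_univ,
    integral_image_eq_integral_abs_deriv_smul MeasurableSet.univ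
      (fun t _ => (Real.hasDerivAt_sigmoid t).hasDerivWithinAt) Real.sigmoid_injective.injOn,
    setIntegral_univ]
  exact integral_congr_ae (Filter.Eventually.of_forall fun t => sigmoid_beta_integrand α y t)

end BetaIntegral

/-! ### The kernels tanh^n cosh^(-2/δ). -/

section Kernel

open MeasureTheory Set

/-- The functions whose Fourier transforms are the deformed Hermite functions. -/
noncomputable def hermiteKernel (δ : ℝ) (n : ℕ) (t : ℝ) : ℝ :=
  Real.sinh (√δ * t) ^ n * Real.cosh (√δ * t) ^ (-(2 / δ) - n)

variable {δ : ℝ}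

theorem hermiteKernel_zero (δ t : ℝ) : hermiteKernel δ 0 t = Real.cosh (√δ * t) ^ (-(2 / δ)) := by
  simp [hermiteKernel]

theorem hermiteKernel_neg_zero (δ t : ℝ) : hermiteKernel δ 0 (-t) = hermiteKernel δ 0 t := by
  rw [hermiteKernel_zero, hermiteKernel_zero, mul_neg, Real.cosh_neg]

/-- This is the convergence of the Beta integral at y = 0, rescaled by t ↦ 2√δ t. -/
theorem integrable_hermiteKernel_zero (hδ : 0 < δ) : Integrable (hermiteKernel δ 0) := by
  have h := (integrable_cosh_rpow_mul_exp (one_div_pos.2 hδ) 0).comp_mul_left'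
    (R := 2 * √δ) (by positivity)
  have h2 := (h.re).const_mul ((2 : ℝ) ^ (2 / δ))
  refine h2.congr (Filter.Eventually.of_forall fun t => ?_)
  have e : 2 * √δ * t / 2 = √δ * t := by ring
  simp only [hermiteKernel_zero, e, Complex.ofReal_zero, mul_zero, zero_mul, Complex.exp_zero,
    mul_one, mul_one_div, RCLike.re_to_complex, Complex.ofReal_re]
  rw [Real.mul_rpow zero_le_two (Real.cosh_pos _).le, ← mul_assoc,
    ← Real.rpow_add two_pos, add_neg_cancel, Real.rpow_zero, one_mul]

theorem continuous_hermiteKernel (δ : ℝ) (n : ℕ) : Continuous (hermiteKernel δ n) := by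
  unfold hermiteKernel
  have h : Continuous fun t => Real.cosh (√δ * t) := by fun_prop
  exact (by fun_prop : Continuous fun t => Real.sinh (√δ * t) ^ n).mul
    (h.rpow_const fun t => Or.inl (Real.cosh_pos _).ne')

theorem abs_sinh_le_cosh (x : ℝ) : |Real.sinh x| ≤ Real.cosh x := by
  rw [Real.abs_sinh, ← Real.cosh_abs]
  exact (Real.sinh_lt_cosh _).le

theorem abs_hermiteKernel_le (δ : ℝ) (n : ℕ) (t : ℝ) :
    |hermiteKernel δ n t| ≤ hermiteKernel δ 0 t := by
  have hc := Real.cosh_pos (√δ * t)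
  rw [hermiteKernel_zero, hermiteKernel, abs_mul, abs_pow,
    abs_of_pos (Real.rpow_pos_of_pos hc _), Real.rpow_sub hc, Real.rpow_natCast, mul_div_left_comm,
    ← div_pow]
  refine mul_le_of_le_one_right (Real.rpow_pos_of_pos hc _).le (pow_le_one₀ (by positivity) ?_)
  exact (div_le_one hc).2 (abs_sinh_le_cosh _)

theorem integrable_hermiteKernel (hδ : 0 < δ) (n : ℕ) : Integrable (hermiteKernel δ n) :=
  (integrable_hermiteKernel_zero hδ).mono' (continuous_hermiteKernel δ n).aestronglyMeasurable
    (Filter.Eventually.of_forall fun t => abs_hermiteKernel_le δ n t)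

theorem hermiteKernel_apply_zero (δ : ℝ) (n : ℕ) :
    hermiteKernel δ n 0 = if n = 0 then 1 else 0 := by
  cases n <;> simp [hermiteKernel]

/-- Differentiation only shifts the index by ±1; after Fourier transform this becomes a three-term
recurrence. At `n = 0` the truncated index `n - 1` carries coefficient 0. -/
theorem hasDerivAt_hermiteKernel (δ : ℝ) (n : ℕ) (t : ℝ) :
    HasDerivAt (hermiteKernel δ n) (√δ * (n * hermiteKernel δ (n - 1) t -
      (2 / δ + n) * hermiteKernel δ (n + 1) t)) t := by
  have hc := Real.cosh_pos (√δ * t)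
  have hl : HasDerivAt (fun t => √δ * t) √δ t := by simpa using (hasDerivAt_id t).const_mul √δ
  have h := (hl.sinh.pow n).mul (hl.cosh.rpow_const (p := -(2 / δ) - n) (Or.inl hc.ne'))
  refine h.congr_deriv ?_
  have e : Real.cosh (√δ * t) ^ (-(2 / δ) - n) * Real.cosh (√δ * t) =
      Real.cosh (√δ * t) ^ (-(2 / δ) - n + 1) := by rw [Real.rpow_add_one hc.ne']
  have e1 : (-(2 / δ) - ((n + 1 : ℕ) : ℝ)) = -(2 / δ) - n - 1 := by push_cast; ring
  simp only [hermiteKernel, e1, Pi.pow_apply]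
  cases n with
  | zero => simp; ring
  | succ n =>
    have e2 : (-(2 / δ) - ((n + 1 : ℕ) : ℝ)) + 1 = -(2 / δ) - n := by push_cast; ring
    rw [e2] at e
    simp only [Nat.add_sub_cancel, ← e]
    push_cast
    ring

end Kernel

/-! ### Fourier transforms of the kernels. -/

section Transform

open MeasureTheory FourierTransform

/-- The Fourier transform of `hermiteKernel`, with the kernel `exp (2ixt)`. -/
noncomputable def hermiteTransform (δ : ℝ) (n : ℕ) (x : ℝ) : ℂ :=
  𝓕 (fun t : ℝ => (hermiteKernel δ n t : ℂ)) (-x / Real.pi)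

variable {δ : ℝ}

/-- The point -x/π turns the normalisation exp(-2πitv) of `𝓕` into exp(2ixt). -/
theorem hermiteTransform_eq_integral (δ : ℝ) (n : ℕ) (x : ℝ) :
    hermiteTransform δ n x =
      ∫ t : ℝ, (hermiteKernel δ n t : ℂ) * Complex.exp (Complex.I * (2 * x) * t) := by
  rw [hermiteTransform, Real.fourier_real_eq_integral_exp_smul]
  refine integral_congr_ae (Filter.Eventually.of_forall fun t => ?_)
  have : (Real.pi : ℂ) ≠ 0 := by exact_mod_cast Real.pi_ne_zero
  simp only [smul_eq_mul]
  rw [mul_comm]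
  congr 2
  push_cast
  field_simp

theorem norm_hermiteTransform_le (δ : ℝ) (n : ℕ) (x : ℝ) :
    ‖hermiteTransform δ n x‖ ≤ ∫ t : ℝ, ‖(hermiteKernel δ n t : ℂ)‖ :=
  VectorFourier.norm_fourierIntegral_le_integral_norm _ _ _ _ _

theorem integrable_hermiteKernel_ofReal (hδ : 0 < δ) (n : ℕ) :
    Integrable fun t : ℝ => (hermiteKernel δ n t : ℂ) :=
  (integrable_hermiteKernel hδ n).ofReal

theorem continuous_hermiteTransform (hδ : 0 < δ) (n : ℕ) :
    Continuous (hermiteTransform δ n) := by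
  have h : Continuous (𝓕 fun t : ℝ => (hermiteKernel δ n t : ℂ)) :=
    VectorFourier.fourierIntegral_continuous Real.continuous_fourierChar
      (by exact continuous_inner) (integrable_hermiteKernel_ofReal hδ n)
  exact h.comp (by fun_prop)

/-- Transform of the derivative formula: differentiating f_n multiplies its transform by 2πi(-x/π) =
-2ix. -/
theorem hermiteTransform_recurrence (hδ : 0 < δ) (n : ℕ) (x : ℝ) :
    2 * x * hermiteTransform δ n x = Complex.I * √δ * (n * hermiteTransform δ (n - 1) x -
      (2 / δ + n) * hermiteTransform δ (n + 1) x) := by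
  have hd : ∀ t, HasDerivAt (fun t : ℝ => (hermiteKernel δ n t : ℂ))
      ((√δ : ℂ) * (n * hermiteKernel δ (n - 1) t - (2 / δ + n) * hermiteKernel δ (n + 1) t)) t := by
    intro t
    refine (hasDerivAt_hermiteKernel δ n t).ofReal_comp.congr_deriv ?_
    push_cast
    ring
  have hI := integrable_hermiteKernel_ofReal hδ
  have hderiv : deriv (fun t : ℝ => (hermiteKernel δ n t : ℂ)) = fun t : ℝ =>
      (√δ : ℂ) * (n * hermiteKernel δ (n - 1) t - (2 / δ + n) * hermiteKernel δ (n + 1) t) :=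
    funext fun t => (hd t).deriv
  have hint : Integrable (deriv fun t : ℝ => (hermiteKernel δ n t : ℂ)) := by
    rw [hderiv]
    exact (((hI (n - 1)).const_mul _).sub ((hI (n + 1)).const_mul _)).const_mul _
  have h := congrFun (Real.fourier_deriv (hI n) (fun t => (hd t).differentiableAt) hint)
    (-x / Real.pi)
  have hpi : (Real.pi : ℂ) ≠ 0 := by exact_mod_cast Real.pi_ne_zero
  have hL : 𝓕 (deriv fun t : ℝ => (hermiteKernel δ n t : ℂ)) (-x / Real.pi) =
      (√δ : ℂ) * (n * hermiteTransform δ (n - 1) x -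
        (2 / δ + n) * hermiteTransform δ (n + 1) x) := by
    have hE : ∀ m, Integrable fun t : ℝ =>
        Complex.exp (((-2 * Real.pi * t * (-x / Real.pi) : ℝ) : ℂ) * Complex.I) *
          (hermiteKernel δ m t : ℂ) := by
      intro m
      refine (hI m).bdd_mul (c := 1) (by fun_prop) (Filter.Eventually.of_forall fun t => ?_)
      rw [Complex.norm_exp_ofReal_mul_I]
    simp only [hermiteTransform, Real.fourier_real_eq_integral_exp_smul, hderiv, smul_eq_mul]
    rw [← integral_const_mul, ← integral_const_mul, ← integral_sub ((hE _).const_mul _)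
      ((hE _).const_mul _), ← integral_const_mul]
    refine integral_congr_ae (Filter.Eventually.of_forall fun t => ?_)
    simp only
    ring
  rw [hL, ← hermiteTransform, smul_eq_mul] at h
  rw [mul_assoc Complex.I, h]
  push_cast
  field_simp
  linear_combination (x * hermiteTransform δ n x) * Complex.I_sq

end Transform

/-! ### The weight function: closed forms and positivity. -/

section Weight

open MeasureTheory

variable {δ : ℝ}

theorem weightIntegrand_eq (δ x t : ℝ) :
    weightIntegrand δ x t = hermiteKernel δ 0 t * Real.cos (2 * x * t) := by
  rw [weightIntegrand, hermiteKernel_zero, Real.rpow_neg (Real.cosh_pos _).le, div_eq_inv_mul]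

theorem integrable_weightIntegrand (hδ : 0 < δ) (x : ℝ) :
    Integrable fun t : ℝ => weightIntegrand δ x t := by
  simp only [weightIntegrand_eq]
  refine (integrable_hermiteKernel hδ 0).mul_bdd (c := 1) (by fun_prop)
    (Filter.Eventually.of_forall fun t => ?_)
  exact Real.abs_cos_le_one _

theorem hermiteTransform_zero (hδ : 0 < δ) (x : ℝ) :
    hermiteTransform δ 0 x = ((√Real.pi * hermiteWeight δ x : ℝ) : ℂ) := by
  have hpi : √Real.pi ≠ 0 := (Real.sqrt_pos.2 Real.pi_pos).ne'
  rw [hermiteWeight, ← mul_assoc, mul_one_div_cancel hpi, one_mul, hermiteTransform_eq_integral]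
  have hI := integrable_hermiteKernel hδ 0
  have hsin : Integrable fun t : ℝ => hermiteKernel δ 0 t * Real.sin (2 * x * t) :=
    hI.mul_bdd (c := 1) (by fun_prop) (Filter.Eventually.of_forall fun t => Real.abs_sin_le_one _)
  have h0 : ∫ t : ℝ, hermiteKernel δ 0 t * Real.sin (2 * x * t) = 0 := by
    have h := integral_neg_eq_self (fun t : ℝ => hermiteKernel δ 0 t * Real.sin (2 * x * t)) volume
    simp only [hermiteKernel_neg_zero, mul_neg, Real.sin_neg, integral_neg] at h
    linarith
  have hC : ∀ t : ℝ, (hermiteKernel δ 0 t : ℂ) * Complex.exp (Complex.I * (2 * x) * t) =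
      ((weightIntegrand δ x t : ℝ) : ℂ) +
        ((hermiteKernel δ 0 t * Real.sin (2 * x * t) : ℝ) : ℂ) * Complex.I := by
    intro t
    rw [weightIntegrand_eq, mul_assoc, mul_comm Complex.I, Complex.exp_mul_I]
    push_cast
    ring
  simp only [hC]
  rw [integral_add (integrable_weightIntegrand hδ x).ofReal (hsin.ofReal.mul_const _),
    integral_mul_const, integral_complex_ofReal, integral_complex_ofReal, h0]
  simp

theorem continuous_hermiteWeight (hδ : 0 < δ) : Continuous (hermiteWeight δ) := by
  have hpi : √Real.pi ≠ 0 := (Real.sqrt_pos.2 Real.pi_pos).ne'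
  have h := Complex.continuous_re.comp (continuous_hermiteTransform hδ 0)
  refine (h.const_mul (√Real.pi)⁻¹).congr fun x => ?_
  rw [Function.comp_apply, hermiteTransform_zero hδ, Complex.ofReal_re, inv_mul_cancel_left₀ hpi]

theorem two_mul_div_sqrt_mul (hδ : 0 < δ) (x t : ℝ) : x / √δ * (2 * √δ * t) = 2 * x * t := by
  have := (Real.sqrt_pos.2 hδ).ne'
  field_simp

theorem hermiteWeight_eq_betaIntegral (hδ : 0 < δ) (x : ℝ) :
    (hermiteWeight δ x : ℂ) = (((2 : ℝ) ^ (2 / δ - 1) / √(Real.pi * δ) : ℝ) : ℂ) *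
      Complex.betaIntegral (((1 / δ : ℝ) : ℂ) + Complex.I * ((x / √δ : ℝ) : ℂ))
        (((1 / δ : ℝ) : ℂ) - Complex.I * ((x / √δ : ℝ) : ℂ)) := by
  have hs := Real.sqrt_pos.2 hδ
  have hpi := Real.sqrt_pos.2 Real.pi_pos
  have hscale := Measure.integral_comp_mul_left (fun t : ℝ =>
    (((2 * Real.cosh (t / 2)) ^ (-(2 * (1 / δ))) : ℝ) : ℂ) *
      Complex.exp (Complex.I * ((x / √δ : ℝ) : ℂ) * t)) (2 * √δ)
  rw [← betaIntegral_eq_integral_cosh_rpow] at hscale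
  have hint : ∀ t : ℝ, (((2 * Real.cosh (2 * √δ * t / 2)) ^ (-(2 * (1 / δ))) : ℝ) : ℂ) *
      Complex.exp (Complex.I * ((x / √δ : ℝ) : ℂ) * ((2 * √δ * t : ℝ) : ℂ)) =
      (((2 : ℝ) ^ (-(2 / δ)) : ℝ) : ℂ) *
        ((hermiteKernel δ 0 t : ℂ) * Complex.exp (Complex.I * (2 * x) * t)) := by
    intro t
    have e : 2 * √δ * t / 2 = √δ * t := by ring
    rw [e, mul_one_div, Real.mul_rpow zero_le_two (Real.cosh_pos _).le, hermiteKernel_zero,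
      mul_assoc Complex.I, ← Complex.ofReal_mul, two_mul_div_sqrt_mul hδ]
    push_cast
    ring_nf
  simp only [hint] at hscale
  rw [integral_const_mul, ← hermiteTransform_eq_integral, hermiteTransform_zero hδ,
    abs_of_pos (by positivity), Complex.real_smul] at hscale
  have h2 : (2 : ℝ) ^ (2 / δ - 1) = ((2 : ℝ) ^ (-(2 / δ)))⁻¹ / 2 := by
    rw [Real.rpow_sub two_pos, Real.rpow_one, Real.rpow_neg zero_le_two, inv_inv]
  have h3 : (0 : ℝ) < (2 : ℝ) ^ (-(2 / δ)) := by positivity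
  rw [h2, Real.sqrt_mul Real.pi_pos.le]
  have h4 : ((2 * √δ : ℝ) : ℂ) ≠ 0 := by exact_mod_cast (by positivity : 2 * √δ ≠ 0)
  rw [Complex.ofReal_inv, eq_inv_mul_iff_mul_eq₀ h4] at hscale
  rw [← hscale]
  norm_cast
  field_simp

theorem hermiteWeight_eq_Gamma (hδ : 0 < δ) (x : ℝ) :
    (hermiteWeight δ x : ℂ) = (((2 : ℝ) ^ (2 / δ - 1) / √(Real.pi * δ) : ℝ) : ℂ) *
      (Complex.Gamma (((1 / δ : ℝ) : ℂ) + Complex.I * ((x / √δ : ℝ) : ℂ)) *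
        Complex.Gamma (((1 / δ : ℝ) : ℂ) - Complex.I * ((x / √δ : ℝ) : ℂ)) /
        Complex.Gamma ((2 / δ : ℝ) : ℂ)) := by
  have h1 : 0 < 1 / δ := one_div_pos.2 hδ
  have h2 : Complex.Gamma ((2 / δ : ℝ) : ℂ) ≠ 0 := by
    rw [Complex.Gamma_ofReal]
    exact_mod_cast (Real.Gamma_pos_of_pos (by positivity)).ne'
  rw [hermiteWeight_eq_betaIntegral hδ, Complex.Gamma_mul_Gamma_eq_betaIntegral
    (by simpa using hδ) (by simpa using hδ)]
  have e : ((1 / δ : ℝ) : ℂ) + Complex.I * ((x / √δ : ℝ) : ℂ) +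
      (((1 / δ : ℝ) : ℂ) - Complex.I * ((x / √δ : ℝ) : ℂ)) = ((2 / δ : ℝ) : ℂ) := by
    push_cast
    ring
  rw [e, mul_div_cancel_left₀ _ h2]

theorem hermiteWeight_eq_norm_Gamma_sq (hδ : 0 < δ) (x : ℝ) :
    hermiteWeight δ x = (2 : ℝ) ^ (2 / δ - 1) / √(Real.pi * δ) *
      (‖Complex.Gamma (((1 / δ : ℝ) : ℂ) + Complex.I * ((x / √δ : ℝ) : ℂ))‖ ^ 2 /
        Real.Gamma (2 / δ)) := by
  have h := hermiteWeight_eq_Gamma hδ x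
  have e : ((1 / δ : ℝ) : ℂ) - Complex.I * ((x / √δ : ℝ) : ℂ) =
      starRingEnd ℂ (((1 / δ : ℝ) : ℂ) + Complex.I * ((x / √δ : ℝ) : ℂ)) := by
    rw [map_add, map_mul, Complex.conj_ofReal, Complex.conj_ofReal, Complex.conj_I]
    ring
  rw [e, Complex.Gamma_conj, Complex.mul_conj, Complex.Gamma_ofReal,
    Complex.normSq_eq_norm_sq] at h
  exact_mod_cast h

/-- Positivity is invisible in the oscillating integral; it is read off from |Γ|², as Γ has no zero
in the right half plane. -/
theorem hermiteWeight_pos (hδ : 0 < δ) (x : ℝ) : 0 < hermiteWeight δ x := by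
  have h : Complex.Gamma (((1 / δ : ℝ) : ℂ) + Complex.I * ((x / √δ : ℝ) : ℂ)) ≠ 0 :=
    Complex.Gamma_ne_zero_of_re_pos (by simpa using hδ)
  have := norm_pos_iff.2 h
  have := Real.Gamma_pos_of_pos (show 0 < 2 / δ by positivity)
  have := Real.pi_pos
  rw [hermiteWeight_eq_norm_Gamma_sq hδ]
  positivity

end Weight

/-! ### Moments, orthogonality and norms. -/

section Orthogonality

open MeasureTheory FourierTransform

variable {δ : ℝ}

/-- The constant relating `hermiteTransform` to the deformed Hermite functions. -/
noncomputable def hermiteTransformConst (δ : ℝ) : ℕ → ℂ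
  | 0 => 1
  | n + 1 => hermiteTransformConst δ n * (-Complex.I * (2 + n * δ) / √δ)

theorem hermiteTransformConst_ne_zero (hδ : 0 < δ) (n : ℕ) : hermiteTransformConst δ n ≠ 0 := by
  induction n with
  | zero => exact one_ne_zero
  | succ n ih =>
    have h1 : ((√δ : ℝ) : ℂ) ≠ 0 := by exact_mod_cast (Real.sqrt_pos.2 hδ).ne'
    have h2 : (2 + n * δ : ℂ) ≠ 0 := by exact_mod_cast (by positivity : (2 + n * δ : ℝ) ≠ 0)
    rw [hermiteTransformConst]
    simp [ih, h1, h2]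

/-- With κ_n = `hermiteTransformConst δ n`, the relations i√δ n κ_n = c_n κ_{n-1} and i√δ(2/δ + n)
κ_n = -κ_{n+1} turn the recurrence of F_n into that of H_n. -/
theorem deformedHermite_mul_hermiteTransform_zero (hδ : 0 < δ) (n : ℕ) (x : ℝ) :
    (((deformedHermite δ n).eval x : ℝ) : ℂ) * hermiteTransform δ 0 x =
      hermiteTransformConst δ n * hermiteTransform δ n x := by
  have h1 : ((√δ : ℝ) : ℂ) ≠ 0 := by exact_mod_cast (Real.sqrt_pos.2 hδ).ne'
  have hδC : (δ : ℂ) ≠ 0 := by exact_mod_cast hδ.ne'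
  have hsq : ((√δ : ℝ) : ℂ) ^ 2 = δ := by exact_mod_cast Real.sq_sqrt hδ.le
  have hk : ∀ n, Complex.I * √δ * (2 / δ + n) * hermiteTransformConst δ n =
      -hermiteTransformConst δ (n + 1) := by
    intro n
    rw [hermiteTransformConst]
    field_simp
    rw [hsq]
  induction n using Nat.strong_induction_on with
  | _ n ih =>
    match n with
    | 0 => simp [deformedHermite, hermiteTransformConst]
    | n + 1 =>
      have hr := hermiteTransform_recurrence hδ n x
      have hc : ((hermiteCoeff δ n * (deformedHermite δ (n - 1)).eval x : ℝ) : ℂ) *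
          hermiteTransform δ 0 x = Complex.I * √δ * n * hermiteTransformConst δ n *
            hermiteTransform δ (n - 1) x := by
        cases n with
        | zero => simp [hermiteCoeff]
        | succ n =>
          rw [Complex.ofReal_mul, mul_assoc, Nat.add_sub_cancel, ih n (by omega),
            hermiteTransformConst, hermiteCoeff]
          push_cast
          field_simp
          linear_combination
            (hermiteTransformConst δ n * hermiteTransform δ n x * (2 + n * δ)) * Complex.I_sq
      have e : ((((deformedHermite δ (n + 1)).eval x : ℝ) : ℂ)) =
          2 * x * (((deformedHermite δ n).eval x : ℝ) : ℂ) -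
            ((hermiteCoeff δ n * (deformedHermite δ (n - 1)).eval x : ℝ) : ℂ) := by
        rw [deformedHermite_succ]
        simp
      rw [e, sub_mul, hc, mul_assoc, ih n (by omega)]
      linear_combination hermiteTransformConst δ n * hr - hermiteTransform δ (n + 1) x * hk n

theorem deformedHermite_mul_hermiteWeight (hδ : 0 < δ) (n : ℕ) (x : ℝ) :
    (((deformedHermite δ n).eval x * hermiteWeight δ x : ℝ) : ℂ) =
      ((√Real.pi : ℝ) : ℂ)⁻¹ * hermiteTransformConst δ n * hermiteTransform δ n x := by
  have hpi : ((√Real.pi : ℝ) : ℂ) ≠ 0 := by exact_mod_cast (Real.sqrt_pos.2 Real.pi_pos).ne'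
  rw [mul_assoc, ← deformedHermite_mul_hermiteTransform_zero hδ, hermiteTransform_zero hδ]
  push_cast
  field_simp

/-- H_n w is a multiple of the transform of an integrable function, hence bounded; each factor x is
traded for neighbouring indices by 2x H_n = H_{n+1} + c_n H_{n-1}. No asymptotics of Γ are needed.
-/
theorem exists_abs_pow_mul_deformedHermite_mul_hermiteWeight_le (hδ : 0 < δ) (k n : ℕ) :
    ∃ B : ℝ, ∀ x : ℝ, |x ^ k * (deformedHermite δ n).eval x * hermiteWeight δ x| ≤ B := by
  induction k generalizing n with
  | zero =>
    refine ⟨‖((√Real.pi : ℝ) : ℂ)⁻¹ * hermiteTransformConst δ n‖ *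
      ∫ t : ℝ, ‖(hermiteKernel δ n t : ℂ)‖, fun x => ?_⟩
    rw [pow_zero, one_mul, ← Real.norm_eq_abs, ← Complex.norm_real,
      deformedHermite_mul_hermiteWeight hδ, norm_mul]
    exact mul_le_mul_of_nonneg_left (norm_hermiteTransform_le δ n x) (norm_nonneg _)
  | succ k ih =>
    obtain ⟨B, hB⟩ := ih (n + 1)
    obtain ⟨B', hB'⟩ := ih (n - 1)
    refine ⟨(B + |hermiteCoeff δ n| * B') / 2, fun x => ?_⟩
    have e : x ^ (k + 1) * (deformedHermite δ n).eval x * hermiteWeight δ x =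
        (x ^ k * (deformedHermite δ (n + 1)).eval x * hermiteWeight δ x +
          hermiteCoeff δ n * (x ^ k * (deformedHermite δ (n - 1)).eval x *
            hermiteWeight δ x)) / 2 := by
      rw [deformedHermite_succ]
      simp
      ring
    rw [e, abs_div, abs_two]
    refine div_le_div_of_nonneg_right ((abs_add_le _ _).trans (add_le_add (hB x) ?_)) zero_le_two
    rw [abs_mul]
    exact mul_le_mul_of_nonneg_left (hB' x) (abs_nonneg _)

theorem integrable_pow_mul_hermiteWeight (hδ : 0 < δ) (k : ℕ) :
    Integrable fun x : ℝ => x ^ k * hermiteWeight δ x := by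
  obtain ⟨B, hB⟩ := exists_abs_pow_mul_deformedHermite_mul_hermiteWeight_le hδ k 0
  -- Bounding x^{k+2} w as well gives domination by a multiple of 1/(1 + x²).
  obtain ⟨B', hB'⟩ := exists_abs_pow_mul_deformedHermite_mul_hermiteWeight_le hδ (k + 2) 0
  simp only [deformedHermite, eval_one, mul_one] at hB hB'
  refine (integrable_inv_one_add_sq.const_mul (B + B')).mono'
    (by have := continuous_hermiteWeight hδ; fun_prop) (Filter.Eventually.of_forall fun x => ?_)
  have hx : 0 < 1 + x ^ 2 := by positivity
  rw [← div_eq_mul_inv, le_div_iff₀ hx, Real.norm_eq_abs]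
  calc |x ^ k * hermiteWeight δ x| * (1 + x ^ 2)
      = |x ^ k * hermiteWeight δ x| + |x ^ (k + 2) * hermiteWeight δ x| := by
        have e : x ^ (k + 2) * hermiteWeight δ x = x ^ k * hermiteWeight δ x * x ^ 2 := by ring
        rw [mul_add, mul_one, e, abs_mul _ (x ^ 2), abs_of_nonneg (sq_nonneg x)]
    _ ≤ B + B' := add_le_add (hB x) (hB' x)

theorem integrable_eval_mul_hermiteWeight (hδ : 0 < δ) (p : ℝ[X]) :
    Integrable fun x : ℝ => p.eval x * hermiteWeight δ x := by
  induction p using Polynomial.induction_on' with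
  | add p q hp hq =>
    simp only [eval_add, add_mul]
    exact hp.add hq
  | monomial n a =>
    simpa only [eval_monomial, mul_assoc] using (integrable_pow_mul_hermiteWeight hδ n).const_mul a

/-- The moment functional of the weight function. -/
noncomputable def hermiteMoment (hδ : 0 < δ) : ℝ[X] →ₗ[ℝ] ℝ where
  toFun p := ∫ x : ℝ, p.eval x * hermiteWeight δ x
  map_add' p q := by
    simp only [eval_add, add_mul]
    exact integral_add (integrable_eval_mul_hermiteWeight hδ p)
      (integrable_eval_mul_hermiteWeight hδ q)
  map_smul' r p := by
    simp only [eval_smul, smul_eq_mul, mul_assoc, integral_const_mul, RingHom.id_apply]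

/-- Fourier inversion at t = 0. Integrability of F_n, needed for it, comes from that of H_n w after
dividing by the nonzero constant κ_n / √π. -/
theorem integral_hermiteTransform (hδ : 0 < δ) (n : ℕ) :
    ∫ x : ℝ, hermiteTransform δ n x = Real.pi * hermiteKernel δ n 0 := by
  have hI : Integrable (hermiteTransform δ n) := by
    have h := ((integrable_eval_mul_hermiteWeight hδ (deformedHermite δ n)).ofReal
      (𝕜 := ℂ)).const_mul (((√Real.pi : ℝ) : ℂ)⁻¹ * hermiteTransformConst δ n)⁻¹
    have hne : ((√Real.pi : ℝ) : ℂ)⁻¹ * hermiteTransformConst δ n ≠ 0 :=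
      mul_ne_zero (inv_ne_zero (by exact_mod_cast (Real.sqrt_pos.2 Real.pi_pos).ne'))
        (hermiteTransformConst_ne_zero hδ n)
    refine h.congr (Filter.Eventually.of_forall fun x => ?_)
    have := deformedHermite_mul_hermiteWeight hδ n x
    simp only [RCLike.ofReal_eq_complex_ofReal]
    rw [this, inv_mul_cancel_left₀ hne]
  have hpi := Real.pi_ne_zero
  have e : ∀ v : ℝ, hermiteTransform δ n (-Real.pi * v) =
      𝓕 (fun t : ℝ => (hermiteKernel δ n t : ℂ)) v := by
    intro v
    rw [hermiteTransform]
    field_simp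
  have hF : Integrable (𝓕 fun t : ℝ => (hermiteKernel δ n t : ℂ)) :=
    (hI.comp_mul_left' (neg_ne_zero.2 hpi)).congr (Filter.Eventually.of_forall e)
  have hinv := (integrable_hermiteKernel_ofReal hδ n).fourierInv_fourier_eq hF
    (v := 0) (Complex.continuous_ofReal.comp (continuous_hermiteKernel δ n)).continuousAt
  have hint := Measure.integral_comp_mul_left (hermiteTransform δ n) (-Real.pi)
  rw [Real.fourierInv_eq'] at hinv
  simp only [inner_zero_right, mul_zero, Complex.ofReal_zero, zero_mul, Complex.exp_zero,
    one_smul] at hinv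
  simp only [e] at hint
  rw [hinv, abs_inv, abs_neg, abs_of_pos Real.pi_pos, Complex.real_smul, Complex.ofReal_inv,
    eq_inv_mul_iff_mul_eq₀ (by exact_mod_cast hpi)] at hint
  exact hint.symm

theorem hermiteMoment_deformedHermite (hδ : 0 < δ) (n : ℕ) :
    hermiteMoment hδ (deformedHermite δ n) = if n = 0 then √Real.pi else 0 := by
  have hpi : ((√Real.pi : ℝ) : ℂ) ≠ 0 := by exact_mod_cast (Real.sqrt_pos.2 Real.pi_pos).ne'
  apply Complex.ofReal_injective
  change ((∫ x : ℝ, (deformedHermite δ n).eval x * hermiteWeight δ x : ℝ) : ℂ) = _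
  rw [← integral_complex_ofReal]
  simp only [deformedHermite_mul_hermiteWeight hδ]
  rw [integral_const_mul, integral_hermiteTransform hδ, hermiteKernel_apply_zero]
  split_ifs with h
  · subst h
    have : (Real.pi : ℂ) = (√Real.pi : ℝ) * (√Real.pi : ℝ) := by
      exact_mod_cast (Real.mul_self_sqrt Real.pi_pos.le).symm
    rw [this, hermiteTransformConst]
    field_simp
    simp
  · simp

/-- Favard's theorem for the deformed Hermite polynomials. -/
theorem deformedHermite_orthogonal_of_recurrence {K : Type*} [CommRing K] {δ : K}
    (L : K[X] →ₗ[K] K) (hL : ∀ n, n ≠ 0 → L (deformedHermite δ n) = 0) (m n : ℕ) (hmn : m < n) :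
    L (deformedHermite δ m * deformedHermite δ n) = 0 := by
  induction m using Nat.strong_induction_on generalizing n with
  | _ m ih =>
    match m with
    | 0 => simpa [deformedHermite] using hL n (by omega)
    | m + 1 =>
      -- Expanding 2x H_m H_n by the recurrence in either index lowers m, while the strict
      -- inequality between the indices is kept.
      have e : deformedHermite δ (m + 1) * deformedHermite δ n =
          deformedHermite δ m * deformedHermite δ (n + 1) +
          hermiteCoeff δ n • (deformedHermite δ m * deformedHermite δ (n - 1)) -
          hermiteCoeff δ m • (deformedHermite δ (m - 1) * deformedHermite δ n) := by
        rw [deformedHermite_succ δ m, deformedHermite_succ δ n, smul_eq_C_mul, smul_eq_C_mul]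
        ring
      rw [e, map_sub, map_add, map_smul, map_smul, ih m (by omega) _ (by omega),
        ih m (by omega) _ (by omega), ih (m - 1) (by omega) _ (by omega)]
      simp

/-- The same exchange at equal indices leaves, modulo orthogonality, L(H_{n+1}²) = c_{n+1} L(H_n²).
-/
theorem deformedHermite_sq_of_recurrence {K : Type*} [CommRing K] {δ : K}
    (L : K[X] →ₗ[K] K) (hL : ∀ n, n ≠ 0 → L (deformedHermite δ n) = 0) (n : ℕ) :
    L (deformedHermite δ n * deformedHermite δ n) =
      L 1 * ∏ j ∈ Finset.range n, hermiteCoeff δ (j + 1) := by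
  induction n with
  | zero => simp [deformedHermite]
  | succ n ih =>
    have e : deformedHermite δ (n + 1) * deformedHermite δ (n + 1) =
        deformedHermite δ n * deformedHermite δ (n + 2) +
        hermiteCoeff δ (n + 1) • (deformedHermite δ n * deformedHermite δ n) -
        hermiteCoeff δ n • (deformedHermite δ (n - 1) * deformedHermite δ (n + 1)) := by
      rw [deformedHermite_succ δ (n + 1), Nat.add_sub_cancel, smul_eq_C_mul, smul_eq_C_mul]
      conv_lhs => rw [deformedHermite_succ δ n]
      conv_rhs => rw [deformedHermite_succ δ n]
      ring
    rw [e, map_sub, map_add, map_smul, map_smul,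
      deformedHermite_orthogonal_of_recurrence L hL n (n + 2) (by omega),
      deformedHermite_orthogonal_of_recurrence L hL (n - 1) (n + 1) (by omega), ih,
      Finset.prod_range_succ]
    simp only [smul_eq_mul]
    ring

theorem prod_hermiteCoeff (δ : ℝ) (n : ℕ) :
    ∏ j ∈ Finset.range n, hermiteCoeff δ (j + 1) =
      2 ^ n * (n.factorial : ℝ) * ∏ j ∈ Finset.range n, (1 + (j : ℝ) * δ / 2) := by
  induction n with
  | zero => simp
  | succ n ih =>
    rw [Finset.prod_range_succ, Finset.prod_range_succ, ih, hermiteCoeff, Nat.factorial_succ]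
    push_cast
    ring

theorem integral_deformedHermite_mul (hδ : 0 < δ) (n m : ℕ) :
    ∫ x : ℝ, (deformedHermite δ n).eval x * (deformedHermite δ m).eval x * hermiteWeight δ x =
      if n = m then √Real.pi * 2 ^ n * (n.factorial : ℝ) *
        ∏ j ∈ Finset.range n, (1 + (j : ℝ) * δ / 2) else 0 := by
  have hL : ∀ n, n ≠ 0 → hermiteMoment hδ (deformedHermite δ n) = 0 := fun n hn => by
    rw [hermiteMoment_deformedHermite, if_neg hn]
  have h1 : hermiteMoment hδ 1 = √Real.pi := hermiteMoment_deformedHermite hδ 0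
  simp only [← eval_mul]
  change hermiteMoment hδ (deformedHermite δ n * deformedHermite δ m) = _
  split_ifs with h
  · rw [← h, deformedHermite_sq_of_recurrence _ hL, h1, prod_hermiteCoeff]
    ring
  · rcases lt_or_gt_of_ne h with h | h
    · exact deformedHermite_orthogonal_of_recurrence _ hL n m h
    · rw [mul_comm]
      exact deformedHermite_orthogonal_of_recurrence _ hL m n h

end Orthogonality

/-! ### The limit δ → 0⁺. -/

section Limit

open MeasureTheory Filter Topology

theorem one_add_sq_div_two_le_cosh (x : ℝ) : 1 + x ^ 2 / 2 ≤ Real.cosh x := by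
  have h := Real.cosh_two_mul (x / 2)
  rw [mul_div_cancel₀ _ two_ne_zero, Real.cosh_sq] at h
  have h2 : (x / 2) ^ 2 ≤ Real.sinh (x / 2) ^ 2 := by
    rw [sq_le_sq, Real.abs_sinh]
    exact Real.self_le_sinh_iff.2 (abs_nonneg _)
  linarith

/-- With p = 2/δ the left side is (1 + t²/p)^p, which tends to exp(t²) and squeezes the cosh power
against the upper bound exp(t²). -/
theorem one_add_div_rpow_le_cosh_rpow {δ : ℝ} (hδ : 0 < δ) (t : ℝ) :
    (1 + t ^ 2 / (2 / δ)) ^ (2 / δ) ≤ Real.cosh (√δ * t) ^ (2 / δ) := by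
  refine Real.rpow_le_rpow (by positivity) ?_ (by positivity)
  convert one_add_sq_div_two_le_cosh (√δ * t) using 2
  rw [mul_pow, Real.sq_sqrt hδ.le]
  field_simp

theorem cosh_rpow_le_exp_sq {δ : ℝ} (hδ : 0 < δ) (t : ℝ) :
    Real.cosh (√δ * t) ^ (2 / δ) ≤ Real.exp (t ^ 2) := by
  refine (Real.rpow_le_rpow (Real.cosh_pos _).le (Real.cosh_le_exp_half_sq _)
    (by positivity)).trans_eq ?_
  rw [← Real.exp_mul, mul_pow, Real.sq_sqrt hδ.le]
  congr 1
  field_simp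

/-- Bernoulli's inequality, which needs exponent 2/δ ≥ 1, hence δ ≤ 2. It yields an integrable
majorant independent of δ. -/
theorem one_add_sq_le_cosh_rpow {δ : ℝ} (hδ : 0 < δ) (hδ2 : δ ≤ 2) (t : ℝ) :
    1 + t ^ 2 ≤ Real.cosh (√δ * t) ^ (2 / δ) := by
  refine le_trans ?_ (one_add_div_rpow_le_cosh_rpow hδ t)
  have hp : 1 ≤ 2 / δ := (one_le_div hδ).2 hδ2
  have h := one_add_mul_self_le_rpow_one_add (s := t ^ 2 / (2 / δ))
    (by have : 0 ≤ t ^ 2 / (2 / δ) := by positivity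
        linarith) hp
  rwa [mul_div_cancel₀ _ (by positivity)] at h

theorem tendsto_two_div_nhdsGT_zero : Tendsto (fun δ : ℝ => 2 / δ) (𝓝[>] 0) atTop := by
  simpa only [div_eq_mul_inv] using tendsto_inv_nhdsGT_zero.const_mul_atTop (two_pos (α := ℝ))

theorem tendsto_cosh_rpow (t : ℝ) : Tendsto (fun δ : ℝ => Real.cosh (√δ * t) ^ (2 / δ)) (𝓝[>] 0)
    (𝓝 (Real.exp (t ^ 2))) := by
  refine tendsto_of_tendsto_of_tendsto_of_le_of_le'
    ((Real.tendsto_one_add_div_rpow_exp (t ^ 2)).comp tendsto_two_div_nhdsGT_zero)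
    tendsto_const_nhds ?_ ?_
  · filter_upwards [self_mem_nhdsWithin] with δ hδ
    exact one_add_div_rpow_le_cosh_rpow hδ t
  · filter_upwards [self_mem_nhdsWithin] with δ hδ
    exact cosh_rpow_le_exp_sq hδ t

theorem integral_cos_div_exp_sq (x : ℝ) :
    ∫ t : ℝ, Real.cos (2 * x * t) / Real.exp (t ^ 2) = √Real.pi * Real.exp (-x ^ 2) := by
  have h := fourierIntegral_gaussian (b := 1) (by simp) (2 * x)
  have hI : Integrable fun t : ℝ => Complex.exp (Complex.I * (2 * x) * t) *
      Complex.exp (-1 * (t : ℂ) ^ 2) := by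
    have := integrable_cexp_quadratic (b := 1) (by simp) (Complex.I * (2 * x)) 0
    refine this.congr (Eventually.of_forall fun t => ?_)
    simp only
    rw [← Complex.exp_add]
    ring_nf
  have h2 := congrArg Complex.re h
  rw [← RCLike.re_to_complex, ← integral_re hI] at h2
  have e1 : ∀ t : ℝ, RCLike.re (Complex.exp (Complex.I * (2 * x) * t) *
      Complex.exp (-1 * (t : ℂ) ^ 2)) = Real.cos (2 * x * t) / Real.exp (t ^ 2) := by
    intro t
    have ea : Complex.exp (-1 * (t : ℂ) ^ 2) = ((Real.exp (-t ^ 2) : ℝ) : ℂ) := by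
      push_cast
      ring_nf
    have eb : Complex.I * (2 * x) * t = ((2 * x * t : ℝ) : ℂ) * Complex.I := by
      push_cast
      ring
    rw [ea, eb, RCLike.re_to_complex, Complex.re_mul_ofReal, Complex.exp_ofReal_mul_I_re,
      Real.exp_neg, div_eq_mul_inv]
  have e2 : ((Real.pi : ℂ) / 1) ^ (1 / 2 : ℂ) * Complex.exp (-(2 * x) ^ 2 / (4 * 1)) =
      ((√Real.pi * Real.exp (-x ^ 2) : ℝ) : ℂ) := by
    rw [Real.sqrt_eq_rpow, Complex.ofReal_mul, Complex.ofReal_cpow Real.pi_pos.le]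
    push_cast
    ring_nf
  rw [integral_congr_ae (Eventually.of_forall e1), e2, Complex.ofReal_re] at h2
  exact h2

/-- The deformed weight tends to the Hermite weight. -/
theorem tendsto_hermiteWeight (x : ℝ) :
    Tendsto (fun δ : ℝ => hermiteWeight δ x) (𝓝[>] 0) (𝓝 (Real.exp (-x ^ 2))) := by
  have hpi := (Real.sqrt_pos.2 Real.pi_pos).ne'
  have h : Tendsto (fun δ : ℝ => ∫ t : ℝ, weightIntegrand δ x t) (𝓝[>] 0)
      (𝓝 (∫ t : ℝ, Real.cos (2 * x * t) / Real.exp (t ^ 2))) := by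
    refine tendsto_integral_filter_of_dominated_convergence (fun t => (1 + t ^ 2)⁻¹) ?_ ?_
      integrable_inv_one_add_sq (Eventually.of_forall fun t => ?_)
    · filter_upwards [self_mem_nhdsWithin] with δ hδ
      exact (integrable_weightIntegrand hδ x).aestronglyMeasurable
    · filter_upwards [Ioc_mem_nhdsGT (two_pos (α := ℝ))] with δ hδ
      refine Eventually.of_forall fun t => ?_
      have h1 := one_add_sq_le_cosh_rpow hδ.1 hδ.2 t
      have h0 : 0 < 1 + t ^ 2 := by positivity
      rw [weightIntegrand, norm_div, Real.norm_of_nonneg (h0.le.trans h1), ← one_div]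
      exact div_le_div₀ zero_le_one (Real.abs_cos_le_one _) h0 h1
    · exact tendsto_const_nhds.div (tendsto_cosh_rpow t) (Real.exp_ne_zero _)
  have h2 := h.const_mul (1 / √Real.pi)
  rwa [integral_cos_div_exp_sq, ← mul_assoc, one_div_mul_cancel hpi, one_mul] at h2

end Limit

theorem mainTheorem5 :
    (∀ δ : ℝ, 0 < δ →
      -- the deformed Hermite polynomials are well defined
      (∀ n : ℕ, ∃! P : Polynomial ℝ, IsDeformedHermite δ n P) ∧
      -- the weight function: the defining integral converges, and its closed forms
      (∀ x : ℝ,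
        MeasureTheory.Integrable (fun t : ℝ => weightIntegrand δ x t) ∧
        0 < hermiteWeight δ x ∧
        (hermiteWeight δ x : ℂ) =
          (((2 : ℝ) ^ (2 / δ - 1) / √(Real.pi * δ) : ℝ) : ℂ) *
            Complex.betaIntegral (((1 / δ : ℝ) : ℂ) + Complex.I * ((x / √δ : ℝ) : ℂ))
              (((1 / δ : ℝ) : ℂ) - Complex.I * ((x / √δ : ℝ) : ℂ)) ∧
        (hermiteWeight δ x : ℂ) =
          (((2 : ℝ) ^ (2 / δ - 1) / √(Real.pi * δ) : ℝ) : ℂ) *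
            (Complex.Gamma (((1 / δ : ℝ) : ℂ) + Complex.I * ((x / √δ : ℝ) : ℂ)) *
              Complex.Gamma (((1 / δ : ℝ) : ℂ) - Complex.I * ((x / √δ : ℝ) : ℂ)) /
              Complex.Gamma ((2 / δ : ℝ) : ℂ)) ∧
        hermiteWeight δ x =
          (2 : ℝ) ^ (2 / δ - 1) / √(Real.pi * δ) *
            (‖Complex.Gamma (((1 / δ : ℝ) : ℂ) + Complex.I * ((x / √δ : ℝ) : ℂ))‖ ^ 2 /
              Real.Gamma (2 / δ))) ∧
      -- orthogonality with the stated norms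
      (∀ H : ℕ → Polynomial ℝ, (∀ n : ℕ, IsDeformedHermite δ n (H n)) →
        ∀ n m : ℕ,
          MeasureTheory.Integrable
            (fun x : ℝ => (H n).eval x * (H m).eval x * hermiteWeight δ x) ∧
          ∫ x : ℝ, (H n).eval x * (H m).eval x * hermiteWeight δ x =
            if n = m then
              √Real.pi * 2 ^ n * (n.factorial : ℝ) *
                ∏ j ∈ Finset.range n, (1 + (j : ℝ) * δ / 2)
            else 0)) ∧
    -- the undeformed limit of the weight function
    (∀ x : ℝ,
      Filter.Tendsto (fun δ : ℝ => hermiteWeight δ x) (nhdsWithin 0 (Set.Ioi 0))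
        (nhds (Real.exp (-x ^ 2)))) := by
  refine ⟨fun δ hδ => ⟨fun n => ?_, fun x => ⟨integrable_weightIntegrand hδ x,
    hermiteWeight_pos hδ x, hermiteWeight_eq_betaIntegral hδ x, hermiteWeight_eq_Gamma hδ x,
    hermiteWeight_eq_norm_Gamma_sq hδ x⟩, fun H hH n m => ?_⟩, tendsto_hermiteWeight⟩
  · exact ⟨deformedHermite δ n, (isDeformedHermite_iff hδ).2 rfl,
      fun P hP => (isDeformedHermite_iff hδ).1 hP⟩
  · rw [(isDeformedHermite_iff hδ).1 (hH n), (isDeformedHermite_iff hδ).1 (hH m)]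
    refine ⟨?_, integral_deformedHermite_mul hδ n m⟩
    simpa only [eval_mul] using
      integrable_eval_mul_hermiteWeight hδ (deformedHermite δ n * deformedHermite δ m)
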